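/- Let $(G,+)$ be an Abelian, Hausdorff, locally compact, second-countable topological group with Borel $\sigma$-algebra $\mathcal G$ and a fixed Haar measure $\lambda_G$. Let $\mathrm M(G)$ be the set of positive Borel measures on $G$ that are finite on compact sets, with the $\sigma$-algebra $\mathcal M(G)$ generated by the maps $\xi\mapsto\xi(K)$, $K$ compact. For $t\in G$ let $\tau_t\xi=\xi(\cdot+t)$. A measure $\mathrm P$ on $\mathrm M(G)$ is *stationary* if it is $\sigma$-finite and $\tau_t\circ\mathrm P=\mathrm P$ (push-forward) for all $t\in G$. It is *ergodic* if it is stationary and, for every $A\in\mathcal M(G)$ with $\tau_tA=A$ for all $t\in G$, either $\mathrm P(A)=0$ or $\mathrm P({}^cA)=0$. A measure $\mathrm P_0$ is the *Palm measure* of a stationary measure $\mathrm P$ if $$\mathrm P_0(A)=\int_{\mathrm M(G)}\int_G\omega(t)\,\mathbf 1(\tau_t\xi\in A)\,\xi(\mathrm dt)\,\mathrm P(\mathrm d\xi),\qquad A\in\mathcal M(G),$$ for every measurable $\omega:G\to\mathbb R_+$ with $\int_G\omega\,\mathrm d\lambda_G=1$. Let $\mathrm F(G)$ be the set of continuous functions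 $B:G\to G$ with $B_0=0$ such that, for every $\xi\in\mathrm M(G)$, the push-forward $(\mathrm{Id}+B)\circ\xi$ is finite on compact sets. Equip it with the cylindrical $\sigma$-algebra $\mathcal F(G)$, and let $\theta_tB=(B_{t+s}-B_t)_{s\in G}$. A measure $\nu$ on $\mathrm F(G)$ is *weakly stationary* if it is $\sigma$-finite and $\theta_t\circ\nu=\nu$ for all $t\in G$. Let $\Gamma(\xi,B)=(\mathrm{Id}+B)\circ\xi$ and $\mathrm P_0^\nu=\Gamma\circ(\mathrm P_0\otimes\nu)$. The pair $(\mathrm P,\nu)$ is *jointly ergodic* if, for every $A\in\mathcal M(G)\otimes\mathcal F(G)$ with $(\tau_t,\theta_t)A=A$ for all $t\in G$, either $\mathrm P\otimes\nu(A)=0$ or $\mathrm P\otimes\nu({}^cA)=0$. **Theorem.** Let $\mathrm P$ be a stationary measure on $\mathrm M(G)$ that gives no mass to the zero measure, let $\mathrm P_0$ be its Palm measure, and let $\nu$ be a weakly stationary measure on $\mathrm F(G)$ such that $\mathrm P_0^\nu$ is $\sigma$-finite. If $(\mathrm P,\nu)$ is jointly ergodic, then the stationary measure $\mathrm P^\nu$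 associated with $\mathrm P_0^\nu$, that is, the unique stationary measure on $\mathrm M(G)$ that gives no mass to the zero measure and whose Palm measure is $\mathrm P_0^\nu$, exists and is ergodic. -/

import Mathlib

open MeasureTheory
open scoped ENNReal NNReal

namespace PalmPerturbation

section Spaces

variable (G : Type*) [TopologicalSpace G] [MeasurableSpace G]

/-- The space `M(G)` of positive measures on `G` that are finite on compact sets. -/
@[ext]
structure LocFinMeasure where
  toMeasure : Measure G
  lt_top_of_isCompact : ∀ K : Set G, IsCompact K → toMeasure K < ∞

/-- The zero measure, written `∅` in point process theory. -/
instance : Zero (LocFinMeasure G) :=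
  ⟨⟨0, fun _ _ => by simp⟩⟩

/-- The `σ`-algebra on `M(G)` generated by the maps `ξ ↦ ξ K`, `K` compact. -/
instance : MeasurableSpace (LocFinMeasure G) :=
  ⨆ K : {K : Set G // IsCompact K},
    MeasurableSpace.comap (fun ξ : LocFinMeasure G => ξ.toMeasure K.1) inferInstance

/-- The space `F(G)` of continuous functions `B : G → G` with `B 0 = 0` and such that the
push-forward of every `ξ ∈ M(G)` by `t ↦ t + B t` is finite on compact sets. -/
@[ext]
structure Displacement [AddGroup G] where
  toFun : G → G
  continuous_toFun : Continuous toFun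
  map_zero_toFun : toFun 0 = 0
  lt_top_of_isCompact : ∀ (ξ : LocFinMeasure G) (K : Set G), IsCompact K →
    (ξ.toMeasure.map fun t => t + toFun t) K < ∞

/-- The cylindrical `σ`-algebra on `F(G)`, generated by the evaluations `B ↦ B t`, `t ∈ G`. -/
instance [AddGroup G] : MeasurableSpace (Displacement G) :=
  ⨆ t : G, MeasurableSpace.comap (fun B : Displacement G => B.toFun t) inferInstance

end Spaces

variable {G : Type*} [AddCommGroup G] [TopologicalSpace G] [IsTopologicalAddGroup G] [T2Space G]
  [MeasurableSpace G] [BorelSpace G]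

/-- The translation `τ_t ξ = ξ(· + t)`, that is `(τ_t ξ)(f) = ∫ f (s - t) ξ(ds)`. -/
noncomputable def translate (t : G) (ξ : LocFinMeasure G) : LocFinMeasure G where
  toMeasure := ξ.toMeasure.map fun s => s - t
  lt_top_of_isCompact K hK := by
    have hc : Continuous fun s : G => s - t := by fun_prop
    rw [Measure.map_apply hc.measurable hK.measurableSet]
    apply ξ.lt_top_of_isCompact
    have h : (fun s : G => s - t) ⁻¹' K = (fun s : G => s + t) '' K := by
      ext s
      simp [sub_eq_add_neg]
    rw [h]
    exact hK.image (by fun_prop)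

/-- The map `Γ(ξ, B) = (Id + B) ∘ ξ`, the push-forward of `ξ` by `t ↦ t + B t`. -/
noncomputable def perturb (p : LocFinMeasure G × Displacement G) : LocFinMeasure G where
  toMeasure := p.1.toMeasure.map fun t => t + p.2.toFun t
  lt_top_of_isCompact := p.2.lt_top_of_isCompact p.1

/-- The shift of increments `(θ_t B)_s = B_{t+s} - B_t`. -/
def shift (t : G) (B : Displacement G) : Displacement G where
  toFun s := B.toFun (t + s) - B.toFun t
  continuous_toFun := by
    have := B.continuous_toFun
    fun_prop
  map_zero_toFun := by simp
  lt_top_of_isCompact ξ K hK := by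
    have hB := B.continuous_toFun
    have hc : Continuous fun s : G => s + (B.toFun (t + s) - B.toFun t) := by fun_prop
    have hd : Continuous fun s : G => s + B.toFun s := by fun_prop
    have he : Continuous fun s : G => s - -t := by fun_prop
    have hK' : IsCompact ((fun s : G => s - (t + B.toFun t)) ⁻¹' K) := by
      have h : (fun s : G => s - (t + B.toFun t)) ⁻¹' K
          = (fun s : G => s + (t + B.toFun t)) '' K := by
        ext s
        simp [sub_eq_add_neg]
      rw [h]
      exact hK.image (by fun_prop)
    have key := B.lt_top_of_isCompact (translate (-t) ξ) _ hK'
    rw [Measure.map_apply hd.measurable hK'.measurableSet] at key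
    simp only [translate] at key
    rw [Measure.map_apply he.measurable (hd.measurable hK'.measurableSet)] at key
    rw [Measure.map_apply hc.measurable hK.measurableSet]
    convert key using 2
    ext s
    simp only [Set.mem_preimage]
    have h1 : s - -t = t + s := by abel
    rw [h1]
    have h2 : t + s + B.toFun (t + s) - (t + B.toFun t)
        = s + (B.toFun (t + s) - B.toFun t) := by abel
    rw [h2]

/-- A measure on `M(G)` is stationary if it is `σ`-finite and invariant under translations. -/
structure IsStationary (P : Measure (LocFinMeasure G)) : Prop where
  sigmaFinite : SigmaFinite P
  map_translate : ∀ t : G, P.map (translate t) = P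

/-- A measure on `F(G)` is weakly stationary if it is `σ`-finite and has stationary increments. -/
structure IsWeaklyStationary (ν : Measure (Displacement G)) : Prop where
  sigmaFinite : SigmaFinite ν
  map_shift : ∀ t : G, ν.map (shift t) = ν

/-- A stationary measure is ergodic if every `τ`-invariant event is null or co-null. -/
structure IsErgodic (P : Measure (LocFinMeasure G)) : Prop where
  isStationary : IsStationary P
  null_or_conull : ∀ A : Set (LocFinMeasure G), MeasurableSet A →
    (∀ t : G, translate t '' A = A) → P A = 0 ∨ P Aᶜ = 0

/-- `(P, ν)` are jointly ergodic if every `(τ, θ)`-invariant event of the product `σ`-algebra is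
null or co-null for `P ⊗ ν`. -/
def IsJointlyErgodic (P : Measure (LocFinMeasure G)) (ν : Measure (Displacement G)) : Prop :=
  ∀ A : Set (LocFinMeasure G × Displacement G), MeasurableSet A →
    (∀ t : G, Prod.map (translate t) (shift t) '' A = A) →
    (P.prod ν) A = 0 ∨ (P.prod ν) Aᶜ = 0

/-- `P₀` is the Palm measure of `P` relative to the Haar measure `lam`:
`P₀(A) = ∫∫ ω(t) 1(τ_t ξ ∈ A) ξ(dt) P(dξ)` for every measurable `ω ≥ 0` of integral one. -/
def IsPalmMeasure (lam : Measure G) (P P₀ : Measure (LocFinMeasure G)) : Prop :=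
  ∀ ω : G → ℝ≥0, Measurable ω → ∫⁻ t, (ω t : ℝ≥0∞) ∂lam = 1 →
    ∀ A : Set (LocFinMeasure G), MeasurableSet A →
      P₀ A = ∫⁻ ξ, ∫⁻ t, (ω t : ℝ≥0∞) * A.indicator 1 (translate t ξ) ∂ξ.toMeasure ∂P

/-- The perturbed measure `P₀^ν = Γ ∘ (P₀ ⊗ ν)`. -/
noncomputable def perturbedMeasure (P₀ : Measure (LocFinMeasure G))
    (ν : Measure (Displacement G)) : Measure (LocFinMeasure G) :=
  (P₀.prod ν).map perturb

/-- `P` is the stationary measure without mass at the zero measure whose Palm measure is `P₀`. -/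
structure IsStationaryMeasureOf (lam : Measure G) (P₀ P : Measure (LocFinMeasure G)) : Prop where
  isStationary : IsStationary P
  zero_null : P {0} = 0
  isPalmMeasure : IsPalmMeasure lam P P₀

end PalmPerturbation

/-!
The perturbed measure `Q = Γ ∘ (P₀ ⊗ ν)` is shown to satisfy Mecke's identity
`∫∫ g(ξ, t) ξ(dt) Q(dξ) = ∫∫ g(τ_t ξ, -t) ξ(dt) Q(dξ)`, which characterises the Palm measures of
stationary measures. For `P₀` this is a mass transport argument (`IsPalmMeasure.isMecke`); it passes
to `Q` because `Γ(τ_t ξ, θ_t B) = τ_{t + B t} Γ(ξ, B)` and `ν` is invariant under every `θ_t`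
(`IsMecke.perturbedMeasure`). Mecke's identity for `P₀` needs no `σ`-finiteness of `P₀`: Tonelli's
theorem for `s`-finite measures is enough.

The Palm transform is inverted through the Campbell measure `C`, the image of `Q ⊗ λ` under
`(ξ, t) ↦ (τ_{-t} ξ, t)`. Mecke's identity says that `ξ(ds) C(d(ξ, t))` is symmetric in `s` and `t`.
If `h(ξ, ·)` is a density that normalises each nonzero `ξ`, the symmetry shows that the first
marginal `P` of `h · C` satisfies `ξ(dt) P(dξ) = C` (`IsMecke.exists_compProd_eq`). Conversely, a
measure without mass at zero is determined by its Campbell measure (`eq_of_compProd_eq`).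
Stationarity, `σ`-finiteness and the Palm formula follow from these two facts. Uniqueness needs
moreover that every measure with Palm measure `Q` has Campbell measure `C`; this is where the
`σ`-finiteness of `Q` makes a measure on rectangles determine `Q ⊗ λ` (`IsPalmMeasure.compProd_eq`).

For ergodicity, let `A` be a translation invariant event. Then `Γ⁻¹ A` is `(τ, θ)`-invariant, hence
null or co-null for `P ⊗ ν`. Invariant null events go over from `P ⊗ ν` to `P₀ ⊗ ν`
(`IsPalmMeasure.prod_eq_zero`), thus to `Q`, and from `Q` to the stationary measure with Palm
measure `Q` (`measure_eq_zero_of_palm`).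
-/

namespace PalmPerturbation

open ProbabilityTheory Set

set_option linter.unusedSectionVars false

/-! ### Measurability on the space of locally finite measures -/

section Kernel

variable {G : Type*} [TopologicalSpace G] [MeasurableSpace G]

theorem measurable_apply_of_isCompact {K : Set G} (hK : IsCompact K) :
    Measurable fun ξ : LocFinMeasure G => ξ.toMeasure K :=
  Measurable.of_comap_le (le_iSup (fun K : {K : Set G // IsCompact K} =>
    MeasurableSpace.comap (fun ξ : LocFinMeasure G => ξ.toMeasure K.1) inferInstance) ⟨K, hK⟩)

theorem measurable_of_apply_isCompact {α : Type*} [MeasurableSpace α] {f : α → LocFinMeasure G}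
    (h : ∀ K, IsCompact K → Measurable fun a => (f a).toMeasure K) : Measurable f := by
  rw [measurable_iff_comap_le, MeasurableSpace.comap_le_iff_le_map]
  refine iSup_le fun K => ?_
  rw [← MeasurableSpace.comap_le_iff_le_map, MeasurableSpace.comap_comp]
  exact (h K.1 K.2).comap_le

theorem eq_zero_iff_compactCovering [SigmaCompactSpace G] (ξ : LocFinMeasure G) :
    ξ = 0 ↔ ∀ n, ξ.toMeasure (compactCovering G n) = 0 := by
  have h0 : (0 : LocFinMeasure G).toMeasure = 0 := rfl
  constructor
  · rintro rfl
    simp [h0]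
  · intro h
    ext1
    rw [h0, ← Measure.measure_univ_eq_zero, ← iUnion_compactCovering]
    exact measure_iUnion_null h

theorem measurableSet_singleton_zero [SigmaCompactSpace G] :
    MeasurableSet ({0} : Set (LocFinMeasure G)) := by
  have h : ({0} : Set (LocFinMeasure G)) =
      ⋂ n, (fun ξ : LocFinMeasure G => ξ.toMeasure (compactCovering G n)) ⁻¹' {0} := by
    ext ξ
    simp [eq_zero_iff_compactCovering]
  rw [h]
  exact MeasurableSet.iInter fun n =>
    measurable_apply_of_isCompact (isCompact_compactCovering G n) (measurableSet_singleton 0)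

variable [T2Space G] [BorelSpace G]

theorem measurable_apply_inter_isCompact {D K : Set G} (hD : MeasurableSet D) (hK : IsCompact K) :
    Measurable fun ξ : LocFinMeasure G => ξ.toMeasure (D ∩ K) := by
  have hgen : ‹MeasurableSpace G› = MeasurableSpace.generateFrom {s : Set G | IsClosed s} := by
    rw [BorelSpace.measurable_eq (α := G), borel_eq_generateFrom_isClosed]
  induction D, hD using MeasurableSpace.induction_on_inter hgen isPiSystem_isClosed with
  | empty => simp
  | basic t ht => exact measurable_apply_of_isCompact (hK.inter_left ht)
  | compl t ht ih =>
    have h (ξ : LocFinMeasure G) :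
        ξ.toMeasure (tᶜ ∩ K) = ξ.toMeasure K - ξ.toMeasure (t ∩ K) := by
      rw [← measure_sdiff inter_subset_right (ht.inter hK.measurableSet).nullMeasurableSet
        ((measure_mono inter_subset_right).trans_lt (ξ.lt_top_of_isCompact K hK)).ne]
      congr 1
      ext x
      simp only [mem_inter_iff, mem_compl_iff, Set.mem_sdiff]
      tauto
    simp_rw [h]
    exact (measurable_apply_of_isCompact hK).sub ih
  | iUnion f hd hf ih =>
    have h (ξ : LocFinMeasure G) :
        ξ.toMeasure ((⋃ i, f i) ∩ K) = ∑' i, ξ.toMeasure (f i ∩ K) := by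
      rw [iUnion_inter, measure_iUnion]
      · exact fun i j hij => (hd hij).mono inter_subset_left inter_subset_left
      · exact fun i => (hf i).inter hK.measurableSet
    simp_rw [h]
    exact Measurable.tsum ih

variable [SigmaCompactSpace G]

theorem measurable_apply {D : Set G} (hD : MeasurableSet D) :
    Measurable fun ξ : LocFinMeasure G => ξ.toMeasure D := by
  have h (ξ : LocFinMeasure G) :
      ξ.toMeasure D = ⨆ n, ξ.toMeasure (D ∩ compactCovering G n) := by
    rw [← Monotone.measure_iUnion, ← inter_iUnion, iUnion_compactCovering, inter_univ]
    exact fun m n hmn => inter_subset_inter_right _ (compactCovering_subset G hmn)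
  simp_rw [h]
  exact Measurable.iSup fun n => measurable_apply_inter_isCompact hD (isCompact_compactCovering G n)

variable (G) in
/-- The tautological kernel `ξ ↦ ξ` from `M(G)` to `G`. -/
def kernel : Kernel (LocFinMeasure G) G where
  toFun ξ := ξ.toMeasure
  measurable' := Measure.measurable_of_measurable_coe _ fun _ hD => measurable_apply hD

@[simp]
theorem kernel_apply (ξ : LocFinMeasure G) : kernel G ξ = ξ.toMeasure := rfl

/-- The fibres of the kernel have finite mass on compact sets but no common bound. A uniform bound
is obtained by splitting `G` into a sequence of relatively compact pieces and `M(G)` according to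
the integer part of the mass of a piece. -/
instance : IsSFiniteKernel (kernel G) := by
  classical
  let D : ℕ → Set G := disjointed (compactCovering G)
  have hD (n) : MeasurableSet (D n) :=
    MeasurableSet.disjointed (fun n => (isCompact_compactCovering G n).measurableSet) n
  have hfin (n) (ξ : LocFinMeasure G) : ξ.toMeasure (D n) < ∞ :=
    (measure_mono (disjointed_subset _ n)).trans_lt
      (ξ.lt_top_of_isCompact _ (isCompact_compactCovering G n))
  let S : ℕ → ℕ → Set (LocFinMeasure G) :=
    fun n m => (fun ξ => ⌊(ξ.toMeasure (D n)).toNNReal⌋₊) ⁻¹' {m}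
  have hS (n m) : MeasurableSet (S n m) :=
    (Nat.measurable_floor.comp (measurable_apply (hD n)).ennreal_toNNReal)
      (measurableSet_singleton m)
  let k : ℕ × ℕ → Kernel (LocFinMeasure G) G :=
    fun p => Kernel.piecewise (hS p.1 p.2) ((kernel G).restrict (hD p.1)) 0
  have hk (p : ℕ × ℕ) : IsFiniteKernel (k p) := by
    refine ⟨⟨(p.2 : ℝ≥0∞) + 1, by finiteness, fun ξ => ?_⟩⟩
    simp only [k, Kernel.piecewise_apply]
    split_ifs with h
    · rw [Kernel.restrict_apply, Measure.restrict_apply_univ, kernel_apply]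
      have h' : ⌊(ξ.toMeasure (D p.1)).toNNReal⌋₊ = p.2 := h
      rw [← ENNReal.coe_toNNReal (hfin p.1 ξ).ne]
      have := (Nat.lt_floor_add_one ((ξ.toMeasure (D p.1)).toNNReal)).le
      rw [h'] at this
      exact_mod_cast this
    · simp
  have hsum : kernel G = Kernel.sum k := by
    ext ξ s hs
    rw [Kernel.sum_apply' _ _ hs, ENNReal.tsum_prod']
    have h1 (n : ℕ) : ∑' m, k (n, m) ξ s = ξ.toMeasure (s ∩ D n) := by
      rw [tsum_eq_single ⌊(ξ.toMeasure (D n)).toNNReal⌋₊]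
      · simp only [k, Kernel.piecewise_apply']
        rw [if_pos (by simp [S]), Kernel.restrict_apply' _ _ _ hs, kernel_apply]
      · intro m hm
        simp only [k, Kernel.piecewise_apply']
        rw [if_neg (by simpa [S] using hm.symm)]
        simp
    simp_rw [h1]
    rw [kernel_apply, ← measure_iUnion, ← inter_iUnion, iUnion_disjointed,
      iUnion_compactCovering, inter_univ]
    · exact fun i j hij => (disjoint_disjointed _ hij).mono inter_subset_right inter_subset_right
    · exact fun i => hs.inter (hD i)
  rw [hsum]
  have (p : ℕ × ℕ) : IsSFiniteKernel (k p) := inferInstance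
  infer_instance

instance (ξ : LocFinMeasure G) : SigmaFinite ξ.toMeasure :=
  have : IsFiniteMeasureOnCompacts ξ.toMeasure := ⟨fun K hK => ξ.lt_top_of_isCompact K hK⟩
  inferInstance

@[fun_prop]
theorem Measurable.lintegral_locFin {α : Type*} [MeasurableSpace α] {ξ : α → LocFinMeasure G}
    (hξ : Measurable ξ) {f : α → G → ℝ≥0∞} (hf : Measurable (Function.uncurry f)) :
    Measurable fun a => ∫⁻ s, f a s ∂(ξ a).toMeasure :=
  Measurable.lintegral_kernel_prod_right (κ := (kernel G).comap ξ hξ) hf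

variable (G) in
/-- Every nonzero locally finite measure can be normalised, measurably, by a density. -/
theorem exists_normalising_density : ∃ h : LocFinMeasure G → G → ℝ≥0∞,
    Measurable (Function.uncurry h) ∧ ∀ ξ : LocFinMeasure G, ξ ≠ 0 →
      ∫⁻ t, h ξ t ∂ξ.toMeasure = 1 := by
  obtain ⟨ε, hε, hε1⟩ := ENNReal.exists_pos_sum_of_countable' (one_ne_zero) ℕ
  -- The compact sets `K n` cover `G`, and each has weighted mass at most `ε n`.
  let K : ℕ → Set G := compactCovering G
  let w : LocFinMeasure G → G → ℝ≥0∞ := fun ξ t =>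
    ∑' n, (K n).indicator (fun _ => ε n / (1 + ξ.toMeasure (K n))) t
  have hK (n) : MeasurableSet (K n) := (isCompact_compactCovering G n).measurableSet
  have hKm (n) : Measurable fun ξ : LocFinMeasure G => ξ.toMeasure (K n) :=
    measurable_apply_of_isCompact (isCompact_compactCovering G n)
  have hw : Measurable (Function.uncurry w) := by
    refine Measurable.tsum fun n => ?_
    have : (fun p : LocFinMeasure G × G =>
        (K n).indicator (fun _ => ε n / (1 + p.1.toMeasure (K n))) p.2) =
        (Prod.snd ⁻¹' K n).indicator fun p : LocFinMeasure G × G =>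
          ε n / (1 + p.1.toMeasure (K n)) := rfl
    change Measurable (fun p : LocFinMeasure G × G =>
        (K n).indicator (fun _ => ε n / (1 + p.1.toMeasure (K n))) p.2)
    rw [this]
    exact Measurable.indicator (by fun_prop) (measurable_snd (hK n))
  have hint (ξ : LocFinMeasure G) : ∫⁻ t, w ξ t ∂ξ.toMeasure =
      ∑' n, ε n / (1 + ξ.toMeasure (K n)) * ξ.toMeasure (K n) := by
    rw [lintegral_tsum fun n => (measurable_const.indicator (hK n)).aemeasurable]
    simp_rw [lintegral_indicator_const (hK _)]
  refine ⟨fun ξ t => w ξ t / ∫⁻ s, w ξ s ∂ξ.toMeasure, ?_, fun ξ hξ => ?_⟩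
  · have hm : Measurable fun p : LocFinMeasure G × G => ∫⁻ s, w p.1 s ∂p.1.toMeasure :=
      Measurable.lintegral_locFin measurable_fst
        (hw.comp ((measurable_fst.comp measurable_fst).prodMk measurable_snd))
    exact hw.div hm
  · simp_rw [div_eq_mul_inv]
    rw [lintegral_mul_const _ (hw.of_uncurry_left (x := ξ))]
    apply ENNReal.mul_inv_cancel
    · rw [hint]
      intro h
      rw [ENNReal.tsum_eq_zero] at h
      refine hξ ((eq_zero_iff_compactCovering ξ).2 fun n => ?_)
      rcases mul_eq_zero.1 (h n) with h' | h'
      · rw [ENNReal.div_eq_zero_iff] at h'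
        rcases h' with h' | h'
        · exact absurd h' (hε n).ne'
        · exact absurd h' (by
            simpa using (ξ.lt_top_of_isCompact _ (isCompact_compactCovering G n)).ne)
      · exact h'
    · rw [hint]
      refine ((ENNReal.tsum_le_tsum fun n => ?_).trans_lt (hε1.trans ENNReal.one_lt_top)).ne
      calc ε n / (1 + ξ.toMeasure (K n)) * ξ.toMeasure (K n)
          ≤ ε n / (1 + ξ.toMeasure (K n)) * (1 + ξ.toMeasure (K n)) := by
            gcongr; exact le_add_self
        _ ≤ ε n := (ENNReal.div_mul_cancel (by simp) (by
            simpa using (ξ.lt_top_of_isCompact _ (isCompact_compactCovering G n)).ne)).le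

end Kernel

/-! ### The two actions of the group -/

section Group

variable {G : Type*} [AddCommGroup G] [TopologicalSpace G] [IsTopologicalAddGroup G] [T2Space G]
  [LocallyCompactSpace G] [SecondCountableTopology G] [MeasurableSpace G] [BorelSpace G]

theorem lintegral_translate (t : G) (ξ : LocFinMeasure G) {f : G → ℝ≥0∞} (hf : Measurable f) :
    ∫⁻ s, f s ∂(translate t ξ).toMeasure = ∫⁻ s, f (s - t) ∂ξ.toMeasure :=
  lintegral_map hf (by fun_prop)

theorem translate_zero (ξ : LocFinMeasure G) : translate 0 ξ = ξ := by
  ext1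
  simp [translate]

theorem translate_translate (s t : G) (ξ : LocFinMeasure G) :
    translate s (translate t ξ) = translate (t + s) ξ := by
  ext1
  simp only [translate]
  rw [Measure.map_map (by fun_prop) (by fun_prop)]
  congr 1
  ext r
  simp [sub_sub]

theorem translate_neg_translate (t : G) (ξ : LocFinMeasure G) :
    translate (-t) (translate t ξ) = ξ := by
  rw [translate_translate, add_neg_cancel, translate_zero]

theorem translate_translate_neg (t : G) (ξ : LocFinMeasure G) :
    translate t (translate (-t) ξ) = ξ := by
  rw [translate_translate, neg_add_cancel, translate_zero]

theorem translate_zero_measure (t : G) : translate t (0 : LocFinMeasure G) = 0 := by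
  ext1
  exact Measure.map_zero _

theorem translate_eq_zero_iff {t : G} {ξ : LocFinMeasure G} : translate t ξ = 0 ↔ ξ = 0 := by
  refine ⟨fun h => ?_, fun h => by rw [h, translate_zero_measure]⟩
  rw [← translate_neg_translate t ξ, h, translate_zero_measure]

theorem image_translate (t : G) (A : Set (LocFinMeasure G)) :
    translate t '' A = translate (-t) ⁻¹' A :=
  congrFun (Set.image_eq_preimage_of_inverse (translate_neg_translate t)
    (translate_translate_neg t)) A

theorem shift_zero (B : Displacement G) : shift 0 B = B := by
  ext1
  funext s
  simp [shift, B.map_zero_toFun]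

theorem shift_shift (s t : G) (B : Displacement G) : shift s (shift t B) = shift (t + s) B := by
  ext1
  funext r
  simp [shift, add_assoc]

theorem shift_shift_neg (t : G) (B : Displacement G) : shift t (shift (-t) B) = B := by
  rw [shift_shift, neg_add_cancel, shift_zero]

theorem shift_toFun_neg (t : G) (B : Displacement G) : (shift t B).toFun (-t) = -B.toFun t := by
  simp [shift, B.map_zero_toFun]

theorem measurable_displacement (B : Displacement G) :
    Measurable fun t => t + B.toFun t := by
  have := B.continuous_toFun
  exact Continuous.measurable (by fun_prop)

theorem lintegral_perturb (p : LocFinMeasure G × Displacement G) {f : G → ℝ≥0∞}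
    (hf : Measurable f) :
    ∫⁻ s, f s ∂(perturb p).toMeasure = ∫⁻ s, f (s + p.2.toFun s) ∂p.1.toMeasure :=
  lintegral_map hf (measurable_displacement _)

theorem perturb_eq_zero_iff {p : LocFinMeasure G × Displacement G} :
    perturb p = 0 ↔ p.1 = 0 := by
  have h0 : (0 : LocFinMeasure G).toMeasure = 0 := rfl
  rw [LocFinMeasure.ext_iff, LocFinMeasure.ext_iff, h0]
  exact Measure.map_eq_zero_iff (measurable_displacement _).aemeasurable

/-- The map `Γ` intertwines the joint action `(τ, θ)` with translations, at a random time. -/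
theorem perturb_translate_shift (t : G) (ξ : LocFinMeasure G) (B : Displacement G) :
    perturb (translate t ξ, shift t B) = translate (t + B.toFun t) (perturb (ξ, B)) := by
  ext1
  simp only [perturb, translate]
  rw [Measure.map_map (measurable_displacement _) (by fun_prop),
    Measure.map_map (by fun_prop) (measurable_displacement _)]
  congr 1
  funext s
  simp only [Function.comp_apply, shift]
  rw [add_sub_cancel]
  abel

@[fun_prop]
theorem measurable_translate {α : Type*} [MeasurableSpace α] {t : α → G} {ξ : α → LocFinMeasure G}
    (ht : Measurable t) (hξ : Measurable ξ) : Measurable fun a => translate (t a) (ξ a) := by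
  refine measurable_of_apply_isCompact fun K hK => ?_
  have h (a : α) : (translate (t a) (ξ a)).toMeasure K =
      ∫⁻ s, K.indicator 1 (s - t a) ∂(ξ a).toMeasure := by
    rw [← lintegral_translate _ _ (measurable_one.indicator hK.measurableSet),
      lintegral_indicator_one hK.measurableSet]
  simp_rw [h]
  exact Measurable.lintegral_locFin hξ
    ((measurable_one.indicator hK.measurableSet).comp (by fun_prop))

theorem measurable_toFun_apply (t : G) : Measurable fun B : Displacement G => B.toFun t :=
  Measurable.of_comap_le (le_iSup (fun t : G =>
    MeasurableSpace.comap (fun B : Displacement G => B.toFun t) inferInstance) t)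

@[fun_prop]
theorem measurable_toFun {α : Type*} [MeasurableSpace α] {B : α → Displacement G} {t : α → G}
    (hB : Measurable B) (ht : Measurable t) : Measurable fun a => (B a).toFun (t a) :=
  have : Measurable (Function.uncurry fun (t : G) (B : Displacement G) => B.toFun t) :=
    measurable_uncurry_of_continuous_of_measurable (fun B => B.continuous_toFun)
      measurable_toFun_apply
  this.comp (ht.prodMk hB)

@[fun_prop]
theorem measurable_shift {α : Type*} [MeasurableSpace α] {t : α → G} {B : α → Displacement G}
    (ht : Measurable t) (hB : Measurable B) : Measurable fun a => shift (t a) (B a) := by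
  rw [measurable_iff_comap_le, MeasurableSpace.comap_le_iff_le_map]
  refine iSup_le fun s => ?_
  rw [← MeasurableSpace.comap_le_iff_le_map, MeasurableSpace.comap_comp]
  refine Measurable.comap_le ?_
  change Measurable fun a => (B a).toFun (t a + s) - (B a).toFun (t a)
  fun_prop

@[fun_prop]
theorem measurable_perturb {α : Type*} [MeasurableSpace α]
    {p : α → LocFinMeasure G × Displacement G} (hp : Measurable p) :
    Measurable fun a => perturb (p a) := by
  refine measurable_of_apply_isCompact fun K hK => ?_
  have h (a : α) : (perturb (p a)).toMeasure K =
      ∫⁻ s, K.indicator 1 (s + (p a).2.toFun s) ∂(p a).1.toMeasure := by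
    rw [← lintegral_perturb (p a) (measurable_one.indicator hK.measurableSet),
      lintegral_indicator_one hK.measurableSet]
  simp_rw [h]
  exact Measurable.lintegral_locFin (by fun_prop)
    ((measurable_one.indicator hK.measurableSet).comp (by fun_prop))

theorem IsStationary.lintegral_translate {P : Measure (LocFinMeasure G)} (hP : IsStationary P)
    (t : G) {f : LocFinMeasure G → ℝ≥0∞} (hf : Measurable f) :
    ∫⁻ ξ, f (translate t ξ) ∂P = ∫⁻ ξ, f ξ ∂P := by
  conv_rhs => rw [← hP.map_translate t]
  exact (lintegral_map hf (by fun_prop)).symm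

theorem IsWeaklyStationary.lintegral_shift {ν : Measure (Displacement G)}
    (hν : IsWeaklyStationary ν) (t : G) {f : Displacement G → ℝ≥0∞} (hf : Measurable f) :
    ∫⁻ B, f (shift t B) ∂ν = ∫⁻ B, f B ∂ν := by
  conv_rhs => rw [← hν.map_shift t]
  exact (lintegral_map hf (by fun_prop)).symm

end Group

/-! ### Palm measures and Mecke's identity -/

section Palm

variable {G : Type*} [AddCommGroup G] [TopologicalSpace G] [IsTopologicalAddGroup G] [T2Space G]
  [LocallyCompactSpace G] [SecondCountableTopology G] [MeasurableSpace G] [BorelSpace G]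

theorem exists_lintegral_eq_one (lam : Measure G) [lam.IsAddHaarMeasure] :
    ∃ ω : G → ℝ≥0, Measurable ω ∧ ∫⁻ t, (ω t : ℝ≥0∞) ∂lam = 1 := by
  obtain ⟨g, hpos, hg, hlt⟩ := exists_pos_lintegral_lt_of_sigmaFinite lam one_ne_zero
  set c := ∫⁻ t, (g t : ℝ≥0∞) ∂lam with hc
  have hctop : c ≠ ∞ := (hlt.trans ENNReal.one_lt_top).ne
  have hc0 : c ≠ 0 := by
    rw [hc, Ne, lintegral_eq_zero_iff (by fun_prop)]
    intro h
    have h' : ∀ᵐ t ∂lam, False := h.mono fun t ht => (hpos t).ne' (by simpa using ht)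
    rw [Filter.eventually_false_iff_eq_bot, ae_eq_bot] at h'
    exact NeZero.ne lam h'
  refine ⟨fun t => g t * c.toNNReal⁻¹, by fun_prop, ?_⟩
  have hc0' : c.toNNReal ≠ 0 := by simp [ENNReal.toNNReal_eq_zero_iff, hc0, hctop]
  simp_rw [ENNReal.coe_mul]
  rw [lintegral_mul_const _ (by fun_prop), ← hc, ENNReal.coe_inv hc0', ENNReal.coe_toNNReal hctop,
    ENNReal.mul_inv_cancel hc0 hctop]

variable {lam : Measure G} [lam.IsAddHaarMeasure] {P P₀ : Measure (LocFinMeasure G)}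

theorem IsPalmMeasure.eq_map (h : IsPalmMeasure lam P P₀) [SFinite P] {ω : G → ℝ≥0}
    (hω : Measurable ω) (hω1 : ∫⁻ t, (ω t : ℝ≥0∞) ∂lam = 1) :
    P₀ = ((P ⊗ₘ kernel G).withDensity fun p => (ω p.2 : ℝ≥0∞)).map
      fun p => translate p.2 p.1 := by
  ext A hA
  rw [h ω hω hω1 A hA, Measure.map_apply (by fun_prop) hA, ← lintegral_indicator_one,
    lintegral_withDensity_eq_lintegral_mul _ (by fun_prop), Measure.lintegral_compProd]
  · rfl
  · exact Measurable.mul (by fun_prop)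
      (measurable_one.indicator ((by fun_prop : Measurable
        fun p : LocFinMeasure G × G => translate p.2 p.1) hA))
  · exact measurable_one.indicator ((by fun_prop : Measurable
        fun p : LocFinMeasure G × G => translate p.2 p.1) hA)
  · exact (by fun_prop : Measurable fun p : LocFinMeasure G × G => translate p.2 p.1) hA

theorem IsPalmMeasure.sFinite (h : IsPalmMeasure lam P P₀) [SFinite P] : SFinite P₀ := by
  obtain ⟨ω, hω, hω1⟩ := exists_lintegral_eq_one lam
  rw [h.eq_map hω hω1]
  infer_instance

theorem IsPalmMeasure.lintegral_eq (h : IsPalmMeasure lam P P₀) [SFinite P] {ω : G → ℝ≥0}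
    (hω : Measurable ω) (hω1 : ∫⁻ t, (ω t : ℝ≥0∞) ∂lam = 1) {f : LocFinMeasure G → ℝ≥0∞}
    (hf : Measurable f) :
    ∫⁻ ξ, f ξ ∂P₀ = ∫⁻ ξ, ∫⁻ t, (ω t : ℝ≥0∞) * f (translate t ξ) ∂ξ.toMeasure ∂P := by
  rw [h.eq_map hω hω1, lintegral_map hf (by fun_prop),
    lintegral_withDensity_eq_lintegral_mul _ (by fun_prop) (by fun_prop),
    Measure.lintegral_compProd (by fun_prop)]
  rfl

theorem IsPalmMeasure.singleton_zero (h : IsPalmMeasure lam P P₀) : P₀ {0} = 0 := by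
  obtain ⟨ω, hω, hω1⟩ := exists_lintegral_eq_one lam
  rw [h ω hω hω1 _ measurableSet_singleton_zero]
  refine (lintegral_congr fun ξ => ?_).trans lintegral_zero
  by_cases hξ : ξ = 0
  · subst hξ
    exact lintegral_zero_measure _
  · refine (lintegral_congr fun t => ?_).trans lintegral_zero
    rw [Set.indicator_of_notMem (by simpa [translate_eq_zero_iff] using hξ), mul_zero]

/-- Mass transport: for a diagonally invariant `F`, the point that carries the weight `ω` may be
either of the two points of `ξ`. The factor `∫ ω(t + u) λ(du) = 1` is inserted, and stationarity
moves `u` from one weight to the other. -/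
theorem IsStationary.lintegral_swap_weight (hP : IsStationary P) {ω : G → ℝ≥0}
    (hω : Measurable ω) (hω1 : ∫⁻ t, (ω t : ℝ≥0∞) ∂lam = 1) {F : LocFinMeasure G × G × G → ℝ≥0∞}
    (hF : Measurable F) (hinv : ∀ ξ s t u, F (translate u ξ, s - u, t - u) = F (ξ, s, t)) :
    ∫⁻ ξ, ∫⁻ s, ∫⁻ t, ω s * F (ξ, s, t) ∂ξ.toMeasure ∂ξ.toMeasure ∂P =
      ∫⁻ ξ, ∫⁻ s, ∫⁻ t, ω t * F (ξ, s, t) ∂ξ.toMeasure ∂ξ.toMeasure ∂P := by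
  have := hP.sigmaFinite
  -- Pulling an integral over the Haar measure out of the three others.
  have hout (W : G × G × G → ℝ≥0∞) (hW : Measurable W) :
      ∫⁻ ξ, ∫⁻ s, ∫⁻ t, (∫⁻ u, W (s, t, u) ∂lam) * F (ξ, s, t) ∂ξ.toMeasure ∂ξ.toMeasure ∂P =
      ∫⁻ u, ∫⁻ ξ, ∫⁻ s, ∫⁻ t, W (s, t, u) * F (ξ, s, t)
        ∂ξ.toMeasure ∂ξ.toMeasure ∂P ∂lam := by
    symm
    rw [lintegral_lintegral_swap (Measurable.aemeasurable (by fun_prop))]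
    refine lintegral_congr fun ξ => ?_
    rw [lintegral_lintegral_swap (Measurable.aemeasurable (by fun_prop))]
    refine lintegral_congr fun s => ?_
    rw [lintegral_lintegral_swap (Measurable.aemeasurable (by fun_prop))]
    refine lintegral_congr fun t => ?_
    rw [lintegral_mul_const _ (by fun_prop)]
  have h1 (s t : G) : (ω s : ℝ≥0∞) = ∫⁻ u, ω s * ω (t + u) ∂lam := by
    rw [lintegral_const_mul _ (by fun_prop),
      lintegral_add_left_eq_self (fun u => (ω u : ℝ≥0∞)), hω1, mul_one]
  have h2 (s t : G) : (ω t : ℝ≥0∞) = ∫⁻ u, ω (s - u) * ω t ∂lam := by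
    rw [lintegral_mul_const _ (by fun_prop),
      lintegral_sub_left_eq_self (fun u => (ω u : ℝ≥0∞)), hω1, one_mul]
  calc _ = ∫⁻ ξ, ∫⁻ s, ∫⁻ t, (∫⁻ u, ω s * ω (t + u) ∂lam) * F (ξ, s, t)
              ∂ξ.toMeasure ∂ξ.toMeasure ∂P := by simp_rw [← h1]
    _ = ∫⁻ u, ∫⁻ ξ, ∫⁻ s, ∫⁻ t, (ω s * ω (t + u)) * F (ξ, s, t)
              ∂ξ.toMeasure ∂ξ.toMeasure ∂P ∂lam :=
        hout (fun p => ω p.1 * ω (p.2.1 + p.2.2)) (by fun_prop)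
    _ = ∫⁻ u, ∫⁻ ξ, ∫⁻ s, ∫⁻ t, (ω (s - u) * ω t) * F (ξ, s, t)
              ∂ξ.toMeasure ∂ξ.toMeasure ∂P ∂lam := by
        refine lintegral_congr fun u => ?_
        rw [← hP.lintegral_translate u (by fun_prop)]
        refine lintegral_congr fun ξ => ?_
        rw [PalmPerturbation.lintegral_translate _ _ (by fun_prop)]
        refine lintegral_congr fun s => ?_
        rw [PalmPerturbation.lintegral_translate _ _ (by fun_prop)]
        simp_rw [hinv, sub_add_cancel]
    _ = ∫⁻ ξ, ∫⁻ s, ∫⁻ t, (∫⁻ u, ω (s - u) * ω t ∂lam) * F (ξ, s, t)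
              ∂ξ.toMeasure ∂ξ.toMeasure ∂P :=
        (hout (fun p => ω (p.1 - p.2.2) * ω p.2.1) (by fun_prop)).symm
    _ = _ := by simp_rw [← h2]

/-- Mecke's identity: under `Q`, the origin and a point of the random measure may be exchanged.
It characterises Palm measures of stationary measures. -/
def IsMecke (Q : Measure (LocFinMeasure G)) : Prop :=
  ∀ g : LocFinMeasure G × G → ℝ≥0∞, Measurable g →
    ∫⁻ ξ, ∫⁻ t, g (ξ, t) ∂ξ.toMeasure ∂Q = ∫⁻ ξ, ∫⁻ t, g (translate t ξ, -t) ∂ξ.toMeasure ∂Q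

theorem IsPalmMeasure.isMecke (h : IsPalmMeasure lam P P₀) (hP : IsStationary P) :
    IsMecke P₀ := by
  intro g hg
  have := hP.sigmaFinite
  obtain ⟨ω, hω, hω1⟩ := exists_lintegral_eq_one lam
  rw [h.lintegral_eq hω hω1 (by fun_prop), h.lintegral_eq hω hω1 (by fun_prop)]
  have key := hP.lintegral_swap_weight hω hω1
    (F := fun p => g (translate p.2.1 p.1, p.2.2 - p.2.1)) (by fun_prop) (fun ξ s t u => by
      simp only [translate_translate, add_sub_cancel, sub_sub_sub_cancel_right])
  refine Eq.trans ?_ (key.trans ?_)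
  · refine lintegral_congr fun ξ => lintegral_congr fun s => ?_
    rw [lintegral_translate _ _ (by fun_prop), lintegral_const_mul _ (by fun_prop)]
  · refine lintegral_congr fun ξ => ?_
    rw [lintegral_lintegral_swap (Measurable.aemeasurable (by fun_prop))]
    refine lintegral_congr fun s => ?_
    rw [lintegral_translate _ _ (by fun_prop), lintegral_const_mul _ (by fun_prop)]
    simp_rw [translate_translate, add_sub_cancel, neg_sub]

/-- Mecke's identity passes to the perturbed measure: for fixed `B` it is the identity of `P₀` for
the function `(ξ, t) ↦ g (Γ(ξ, B), t + B t)`, and moving the origin to the perturbed point replaces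
`B` by `θ_t B`, which has the same law. -/
theorem IsMecke.perturbedMeasure [SFinite P₀] (h : IsMecke P₀) {ν : Measure (Displacement G)}
    (hν : IsWeaklyStationary ν) : IsMecke (perturbedMeasure P₀ ν) := by
  intro g hg
  have := hν.sigmaFinite
  have hΓ : Measurable (perturb : LocFinMeasure G × Displacement G → _) :=
    measurable_perturb measurable_id
  rw [PalmPerturbation.perturbedMeasure, lintegral_map (by fun_prop) hΓ,
    lintegral_map (by fun_prop) hΓ, lintegral_prod_symm' _ (by fun_prop),
    lintegral_prod _ (Measurable.aemeasurable (by fun_prop))]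
  calc _ = ∫⁻ B, ∫⁻ ξ, ∫⁻ t, g (perturb (ξ, B), t + B.toFun t) ∂ξ.toMeasure ∂P₀ ∂ν := by
        refine lintegral_congr fun B => lintegral_congr fun ξ => ?_
        rw [lintegral_perturb _ (by fun_prop)]
    _ = ∫⁻ B, ∫⁻ ξ, ∫⁻ t, g (perturb (translate t ξ, B), -t + B.toFun (-t))
          ∂ξ.toMeasure ∂P₀ ∂ν :=
        lintegral_congr fun B => h (fun p => g (perturb (p.1, B), p.2 + B.toFun p.2)) (by fun_prop)
    _ = ∫⁻ ξ, ∫⁻ t, ∫⁻ B, g (perturb (translate t ξ, B), -t + B.toFun (-t))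
          ∂ν ∂ξ.toMeasure ∂P₀ := by
        rw [lintegral_lintegral_swap (Measurable.aemeasurable (by fun_prop))]
        exact lintegral_congr fun ξ =>
          lintegral_lintegral_swap (Measurable.aemeasurable (by fun_prop))
    _ = ∫⁻ ξ, ∫⁻ t, ∫⁻ B, g (translate (t + B.toFun t) (perturb (ξ, B)), -(t + B.toFun t))
          ∂ν ∂ξ.toMeasure ∂P₀ := by
        refine lintegral_congr fun ξ => lintegral_congr fun t => ?_
        rw [← hν.lintegral_shift t (by fun_prop)]
        simp_rw [perturb_translate_shift, shift_toFun_neg, neg_add]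
    _ = _ := by
        refine lintegral_congr fun ξ => ?_
        rw [lintegral_lintegral_swap (Measurable.aemeasurable (by fun_prop))]
        refine lintegral_congr fun B => ?_
        rw [lintegral_perturb _ (by fun_prop)]

theorem perturbedMeasure_singleton_zero {ν : Measure (Displacement G)} [SFinite ν]
    (h : P₀ {0} = 0) : perturbedMeasure P₀ ν {0} = 0 := by
  have hΓ : Measurable (perturb : LocFinMeasure G × Displacement G → _) :=
    measurable_perturb measurable_id
  rw [perturbedMeasure, Measure.map_apply hΓ measurableSet_singleton_zero]
  have : perturb ⁻¹' {(0 : LocFinMeasure G)} =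
      ({0} : Set (LocFinMeasure G)) ×ˢ (Set.univ : Set (Displacement G)) := by
    ext p
    simp [perturb_eq_zero_iff]
  rw [this, Measure.prod_prod, h, zero_mul]

end Palm

/-! ### Campbell measures and the inversion of the Palm transform -/

section Campbell

variable {G : Type*} [AddCommGroup G] [TopologicalSpace G] [IsTopologicalAddGroup G] [T2Space G]
  [LocallyCompactSpace G] [SecondCountableTopology G] [MeasurableSpace G] [BorelSpace G]

/-- The Campbell measure on `M(G) × G` attached to `Q`: the image of `Q ⊗ λ` under
`(ξ, t) ↦ (τ_{-t} ξ, t)`. When `Q` is the Palm measure of `P`, it is `ξ(dt) P(dξ)`. -/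
noncomputable def campbell (lam : Measure G) (Q : Measure (LocFinMeasure G)) :
    Measure (LocFinMeasure G × G) :=
  (Q.prod lam).map fun p => (translate (-p.2) p.1, p.2)

variable {lam : Measure G} [lam.IsAddHaarMeasure] {P P' Q : Measure (LocFinMeasure G)}

instance [SFinite Q] : SFinite (campbell lam Q) := by
  unfold campbell
  infer_instance

theorem lintegral_campbell [SFinite Q] {F : LocFinMeasure G × G → ℝ≥0∞} (hF : Measurable F) :
    ∫⁻ p, F p ∂(campbell lam Q) = ∫⁻ ξ, ∫⁻ t, F (translate (-t) ξ, t) ∂lam ∂Q := by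
  rw [campbell, lintegral_map hF (by fun_prop),
    lintegral_prod _ (Measurable.aemeasurable (by fun_prop))]

/-- In terms of the Campbell measure, Mecke's identity is the symmetry of
`ξ(ds) C(d(ξ, t))` in `s` and `t`. -/
theorem IsMecke.lintegral_campbell_symm [SFinite Q] (hQ : IsMecke Q)
    {F : LocFinMeasure G × G × G → ℝ≥0∞} (hF : Measurable F) :
    ∫⁻ p, ∫⁻ s, F (p.1, p.2, s) ∂p.1.toMeasure ∂(campbell lam Q) =
      ∫⁻ p, ∫⁻ s, F (p.1, s, p.2) ∂p.1.toMeasure ∂(campbell lam Q) := by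
  rw [lintegral_campbell (by fun_prop), lintegral_campbell (by fun_prop)]
  have hsub (t : G) (ξ : LocFinMeasure G) {f : G → ℝ≥0∞} (hf : Measurable f) :
      ∫⁻ s, f s ∂(translate (-t) ξ).toMeasure = ∫⁻ s, f (s + t) ∂ξ.toMeasure := by
    rw [lintegral_translate _ _ hf]
    simp_rw [sub_neg_eq_add]
  calc _ = ∫⁻ ξ, ∫⁻ s, ∫⁻ t, F (translate (-t) ξ, t, s + t) ∂lam ∂ξ.toMeasure ∂Q := by
        refine lintegral_congr fun ξ => ?_
        rw [lintegral_lintegral_swap (Measurable.aemeasurable (by fun_prop))]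
        refine lintegral_congr fun t => ?_
        rw [hsub _ _ (by fun_prop)]
    _ = ∫⁻ ξ, ∫⁻ s, ∫⁻ t, F (translate (-t) (translate s ξ), t, -s + t)
          ∂lam ∂ξ.toMeasure ∂Q :=
        hQ (fun p => ∫⁻ t, F (translate (-t) p.1, t, p.2 + t) ∂lam) (by fun_prop)
    _ = ∫⁻ ξ, ∫⁻ s, ∫⁻ t, F (translate (-t) ξ, s + t, t) ∂lam ∂ξ.toMeasure ∂Q := by
        refine lintegral_congr fun ξ => lintegral_congr fun s => ?_
        rw [← lintegral_add_left_eq_self _ s]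
        refine lintegral_congr fun t => ?_
        simp only [translate_translate, neg_add_cancel_left, neg_add, add_neg_cancel_left]
    _ = _ := by
        refine lintegral_congr fun ξ => ?_
        rw [lintegral_lintegral_swap (Measurable.aemeasurable (by fun_prop))]
        refine lintegral_congr fun t => ?_
        rw [hsub _ _ (by fun_prop)]

theorem lintegral_campbell_translate [SFinite Q] (u : G) {F : LocFinMeasure G × G → ℝ≥0∞}
    (hF : Measurable F) :
    ∫⁻ p, F (translate u p.1, p.2 - u) ∂(campbell lam Q) = ∫⁻ p, F p ∂(campbell lam Q) := by
  rw [lintegral_campbell (by fun_prop), lintegral_campbell hF]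
  refine lintegral_congr fun ξ => ?_
  rw [← lintegral_sub_right_eq_self (fun t => F (translate (-t) ξ, t)) u]
  refine lintegral_congr fun t => ?_
  rw [translate_translate, neg_sub, neg_add_eq_sub]

theorem ae_campbell_ne_zero [SFinite Q] (hQ : Q {0} = 0) :
    ∀ᵐ p ∂(campbell lam Q), p.1 ≠ 0 := by
  have hm : MeasurableSet {p : LocFinMeasure G × G | p.1 ≠ 0} :=
    measurable_fst measurableSet_singleton_zero.compl
  rw [campbell, ae_map_iff (by fun_prop) hm]
  refine (Measure.quasiMeasurePreserving_fst (μ := Q) (ν := lam)).ae (p := fun ξ => ξ ≠ 0) ?_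
    |>.mono fun p hp => by simpa [translate_eq_zero_iff] using hp
  rw [ae_iff]
  simpa using hQ

/-- A measure without mass at zero is recovered from its Campbell measure. -/
theorem lintegral_eq_of_compProd_eq [SFinite P] (hP0 : P {0} = 0)
    {C : Measure (LocFinMeasure G × G)} (hC : P ⊗ₘ kernel G = C)
    {h : LocFinMeasure G → G → ℝ≥0∞} (hh : Measurable (Function.uncurry h))
    (h1 : ∀ ξ : LocFinMeasure G, ξ ≠ 0 → ∫⁻ t, h ξ t ∂ξ.toMeasure = 1)
    {f : LocFinMeasure G → ℝ≥0∞} (hf : Measurable f) :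
    ∫⁻ ξ, f ξ ∂P = ∫⁻ p, Function.uncurry h p * f p.1 ∂C := by
  rw [← hC, Measure.lintegral_compProd (by fun_prop)]
  refine lintegral_congr_ae ?_
  have h0 : ∀ᵐ ξ ∂P, ξ ≠ 0 := by
    rw [ae_iff]
    simpa using hP0
  filter_upwards [h0] with ξ hξ
  change _ = ∫⁻ s, h ξ s * f ξ ∂ξ.toMeasure
  rw [lintegral_mul_const _ hh.of_uncurry_left, h1 ξ hξ, one_mul]

theorem eq_of_compProd_eq [SFinite P] [SFinite P'] (hP0 : P {0} = 0) (hP0' : P' {0} = 0)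
    (h : P ⊗ₘ kernel G = P' ⊗ₘ kernel G) : P = P' := by
  obtain ⟨k, hk, hk1⟩ := exists_normalising_density G
  refine Measure.ext_of_lintegral _ fun f hf => ?_
  rw [lintegral_eq_of_compProd_eq hP0 h hk hk1 hf, lintegral_eq_of_compProd_eq hP0' rfl hk hk1 hf]

/-- Under Mecke's identity, the Campbell measure of `Q` disintegrates as `ξ(dt) P(dξ)`; here `P` is
the first marginal of `h · C`, with `h ξ` a density that normalises `ξ`. -/
theorem IsMecke.exists_compProd_eq [SFinite Q] (hQ : IsMecke Q) (hQ0 : Q {0} = 0) :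
    ∃ P : Measure (LocFinMeasure G), SFinite P ∧ P {0} = 0 ∧
      P ⊗ₘ kernel G = campbell lam Q := by
  obtain ⟨h, hh, h1⟩ := exists_normalising_density G
  let P := ((campbell lam Q).withDensity (Function.uncurry h)).map Prod.fst
  have hP : SFinite P := inferInstance
  have hae := ae_campbell_ne_zero (lam := lam) hQ0
  refine ⟨P, hP, ?_, Measure.ext_of_lintegral _ fun f hf => ?_⟩
  · rw [Measure.map_apply measurable_fst measurableSet_singleton_zero]
    refine withDensity_absolutelyContinuous _ _ ?_
    rw [ae_iff] at hae
    simpa [preimage] using hae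
  · rw [Measure.lintegral_compProd hf, lintegral_map (by fun_prop) measurable_fst,
      lintegral_withDensity_eq_lintegral_mul _ hh (by fun_prop)]
    calc _ = ∫⁻ p, ∫⁻ s, Function.uncurry h (p.1, p.2) * f (p.1, s)
            ∂p.1.toMeasure ∂(campbell lam Q) := by
          refine lintegral_congr fun p => ?_
          rw [lintegral_const_mul _ (by fun_prop)]
          rfl
      _ = ∫⁻ p, ∫⁻ s, Function.uncurry h (p.1, s) * f (p.1, p.2)
            ∂p.1.toMeasure ∂(campbell lam Q) :=
          hQ.lintegral_campbell_symm
            (F := fun q => Function.uncurry h (q.1, q.2.1) * f (q.1, q.2.2)) (by fun_prop)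
      _ = _ := by
          refine lintegral_congr_ae ?_
          filter_upwards [hae] with p hp
          rw [lintegral_mul_const _ (by fun_prop)]
          simp only [Function.uncurry]
          rw [h1 _ hp, one_mul]

theorem map_translate_eq_of_compProd_eq [SFinite P] [SFinite Q] (hP0 : P {0} = 0)
    (h : P ⊗ₘ kernel G = campbell lam Q) (u : G) : P.map (translate u) = P := by
  have ht : Measurable (translate u : LocFinMeasure G → _) := by fun_prop
  refine eq_of_compProd_eq ?_ hP0 (Measure.ext_of_lintegral _ fun f hf => ?_)
  · rw [Measure.map_apply ht measurableSet_singleton_zero]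
    convert hP0
    ext ξ
    simp [translate_eq_zero_iff]
  · rw [Measure.lintegral_compProd hf, lintegral_map (by simp only [kernel_apply]; fun_prop) ht, h,
      ← lintegral_campbell_translate u hf, ← h, Measure.lintegral_compProd (by fun_prop)]
    refine lintegral_congr fun ξ => ?_
    simp only [kernel_apply]
    rw [lintegral_translate _ _ (by fun_prop)]

theorem sigmaFinite_of_compProd_eq [SFinite P] [SigmaFinite Q] (hP0 : P {0} = 0)
    (h : P ⊗ₘ kernel G = campbell lam Q) : SigmaFinite P := by
  -- A positive integrable function for the Campbell measure integrates, along the fibres, to a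
  -- `P`-integrable function that is positive away from the zero measure.
  obtain ⟨g, hpos, hg, hlt⟩ :=
    exists_pos_lintegral_lt_of_sigmaFinite (Q.prod lam) one_ne_zero
  let Φ : LocFinMeasure G → ℝ≥0∞ := fun ξ => ∫⁻ t, g (translate t ξ, t) ∂ξ.toMeasure
  have hΦ : Measurable Φ := by fun_prop
  have hΦint : ∫⁻ ξ, Φ ξ ∂P < ∞ := by
    have h' : ∫⁻ ξ, Φ ξ ∂P = ∫⁻ p, (g (translate p.2 p.1, p.2) : ℝ≥0∞) ∂(campbell lam Q) := by
      rw [← h, Measure.lintegral_compProd (by fun_prop)]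
      rfl
    rw [h', lintegral_campbell (by fun_prop)]
    simp_rw [translate_translate_neg]
    rw [← lintegral_prod (fun p => (g p : ℝ≥0∞)) (Measurable.aemeasurable (by fun_prop))]
    exact hlt.trans ENNReal.one_lt_top
  refine ⟨⟨{ set := fun n => {0} ∪ {ξ | ((n : ℝ≥0∞) + 1)⁻¹ ≤ Φ ξ}
             set_mem := fun _ => trivial
             finite := fun n => ?_
             spanning := ?_ }⟩⟩
  · refine measure_union_lt_top (by simp [hP0]) ?_
    refine (meas_ge_le_lintegral_div hΦ.aemeasurable (by simp) (by simp)).trans_lt ?_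
    exact ENNReal.div_lt_top hΦint.ne (by simp)
  · refine eq_univ_of_forall fun ξ => mem_iUnion.2 ?_
    by_cases hξ : ξ = 0
    · exact ⟨0, Or.inl hξ⟩
    · have hne : Φ ξ ≠ 0 := by
        intro h0
        rw [lintegral_eq_zero_iff (by fun_prop)] at h0
        have h' : ∀ᵐ t ∂ξ.toMeasure, False :=
          h0.mono fun t ht => (hpos _).ne' (by simpa using ht)
        rw [Filter.eventually_false_iff_eq_bot, ae_eq_bot] at h'
        exact hξ (LocFinMeasure.ext h')
      obtain ⟨n, hn⟩ := ENNReal.exists_inv_nat_lt hne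
      refine ⟨n, Or.inr (le_trans ?_ hn.le)⟩
      exact ENNReal.inv_le_inv.2 le_self_add

theorem isPalmMeasure_of_compProd_eq [SFinite P] [SFinite Q]
    (h : P ⊗ₘ kernel G = campbell lam Q) : IsPalmMeasure lam P Q := by
  intro ω hω hω1 A hA
  have hA1 : Measurable (A.indicator (1 : LocFinMeasure G → ℝ≥0∞)) := measurable_one.indicator hA
  have h' : ∫⁻ ξ, ∫⁻ t, (ω t : ℝ≥0∞) * A.indicator 1 (translate t ξ) ∂ξ.toMeasure ∂P =
      ∫⁻ p, (ω p.2 : ℝ≥0∞) * A.indicator 1 (translate p.2 p.1) ∂(campbell lam Q) := by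
    rw [← h, Measure.lintegral_compProd (by fun_prop)]
    rfl
  rw [h', lintegral_campbell (by fun_prop)]
  simp_rw [translate_translate_neg]
  rw [← lintegral_indicator_one hA]
  refine lintegral_congr fun ξ => ?_
  rw [lintegral_mul_const _ (by fun_prop), hω1, one_mul]

/-- The refined Campbell formula: a measure with a `σ`-finite Palm measure `Q` has the Campbell
measure of `Q`. -/
theorem IsPalmMeasure.compProd_eq [SFinite P] [SigmaFinite Q] (h : IsPalmMeasure lam P Q) :
    P ⊗ₘ kernel G = campbell lam Q := by
  have hτ : Measurable fun p : LocFinMeasure G × G => (translate p.2 p.1, p.2) := by fun_prop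
  set ρ := (P ⊗ₘ kernel G).map fun p => (translate p.2 p.1, p.2) with hρ
  have hI (ω : G → ℝ≥0) (hω : Measurable ω) (hω1 : ∫⁻ t, (ω t : ℝ≥0∞) ∂lam = 1)
      (A : Set (LocFinMeasure G)) (hA : MeasurableSet A) :
      ∫⁻ p, (ω p.2 : ℝ≥0∞) * A.indicator 1 p.1 ∂ρ = Q A := by
    have hA1 : Measurable (A.indicator (1 : LocFinMeasure G → ℝ≥0∞)) := measurable_one.indicator hA
    rw [h ω hω hω1 A hA, hρ, lintegral_map (by fun_prop) hτ,
      Measure.lintegral_compProd (by fun_prop)]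
    rfl
  obtain ⟨ω, hω, hω1⟩ := exists_lintegral_eq_one lam
  have hfin (A : Set (LocFinMeasure G)) (D : Set G) (hA : MeasurableSet A) (hD : MeasurableSet D)
      (hQA : Q A ≠ ∞) (hlD : lam D ≠ ∞) : ρ (A ×ˢ D) = Q A * lam D := by
    have hA1 : Measurable (A.indicator (1 : LocFinMeasure G → ℝ≥0∞)) := measurable_one.indicator hA
    have hD1 : Measurable (D.indicator (1 : G → ℝ≥0)) := measurable_one.indicator hD
    -- The weight `ω + 1_D` has integral `1 + λ D > 0`, even when `λ D = 0`.
    let c : ℝ≥0 := 1 + (lam D).toNNReal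
    have hc : (c : ℝ≥0∞) = 1 + lam D := by simp [c, ENNReal.coe_toNNReal hlD]
    have hc0 : c ≠ 0 := by positivity
    have hind : ∀ t, ((D.indicator (1 : G → ℝ≥0) t : ℝ≥0) : ℝ≥0∞) = D.indicator 1 t := by
      intro t
      by_cases ht : t ∈ D <;> simp [ht]
    have hcoe (t : G) : (((ω t + D.indicator 1 t) * c⁻¹ : ℝ≥0) : ℝ≥0∞) =
        (ω t + D.indicator 1 t) * (c : ℝ≥0∞)⁻¹ := by
      rw [ENNReal.coe_mul, ENNReal.coe_inv hc0, ENNReal.coe_add, hind]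
    have hD1' : Measurable (D.indicator (1 : G → ℝ≥0∞)) := measurable_one.indicator hD
    have key := hI (fun t => (ω t + D.indicator 1 t) * c⁻¹) (by fun_prop) (by
      simp_rw [hcoe]
      rw [lintegral_mul_const _ (by fun_prop), lintegral_add_left (by fun_prop), hω1,
        lintegral_indicator_one hD, ← hc, ENNReal.mul_inv_cancel (by simpa using hc0) (by simp)])
      A hA
    have hsplit (p : LocFinMeasure G × G) :
        (((ω p.2 + D.indicator 1 p.2) * c⁻¹ : ℝ≥0) : ℝ≥0∞) * A.indicator 1 p.1 =
        (ω p.2 * A.indicator 1 p.1 + (A ×ˢ D).indicator 1 p) * (c : ℝ≥0∞)⁻¹ := by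
      have : (A ×ˢ D).indicator (1 : LocFinMeasure G × G → ℝ≥0∞) p =
          D.indicator 1 p.2 * A.indicator 1 p.1 := by
        by_cases h1 : p.1 ∈ A <;> by_cases h2 : p.2 ∈ D <;> simp [indicator, h1, h2]
      rw [hcoe, this]
      ring
    have hAD1 : Measurable ((A ×ˢ D).indicator (1 : LocFinMeasure G × G → ℝ≥0∞)) :=
      measurable_one.indicator (hA.prod hD)
    simp_rw [hsplit] at key
    rw [lintegral_mul_const _ (by fun_prop), lintegral_add_left (by fun_prop),
      hI ω hω hω1 A hA, lintegral_indicator_one (hA.prod hD)] at key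
    have key' : Q A + ρ (A ×ˢ D) = Q A + Q A * lam D := by
      calc Q A + ρ (A ×ˢ D) = (Q A + ρ (A ×ˢ D)) * (c : ℝ≥0∞)⁻¹ * c := by
            rw [mul_assoc, ENNReal.inv_mul_cancel (by simpa using hc0) (by simp), mul_one]
        _ = Q A + Q A * lam D := by rw [key, hc, mul_add, mul_one]
    exact (ENNReal.add_right_inj hQA).1 key'
  have hprod : Q.prod lam = ρ := by
    refine Measure.prod_eq fun A D hA hD => ?_
    have hU : A ×ˢ D = ⋃ n, (A ∩ spanningSets Q n) ×ˢ (D ∩ spanningSets lam n) := by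
      rw [iUnion_prod_of_monotone
        (fun m n hmn => inter_subset_inter_right _ (monotone_spanningSets Q hmn))
        (fun m n hmn => inter_subset_inter_right _ (monotone_spanningSets lam hmn)),
        ← inter_iUnion, ← inter_iUnion, iUnion_spanningSets, iUnion_spanningSets, inter_univ,
        inter_univ]
    have hmono : Monotone fun n => (A ∩ spanningSets Q n) ×ˢ (D ∩ spanningSets lam n) :=
      fun m n hmn => prod_mono (inter_subset_inter_right _ (monotone_spanningSets Q hmn))
        (inter_subset_inter_right _ (monotone_spanningSets lam hmn))
    rw [← Measure.prod_prod, hU, hmono.measure_iUnion, hmono.measure_iUnion]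
    refine iSup_congr fun n => ?_
    rw [Measure.prod_prod]
    exact hfin _ _ (hA.inter (measurableSet_spanningSets Q n))
      (hD.inter (measurableSet_spanningSets lam n))
      ((measure_mono inter_subset_right).trans_lt (measure_spanningSets_lt_top Q n)).ne
      ((measure_mono inter_subset_right).trans_lt (measure_spanningSets_lt_top lam n)).ne
  rw [campbell, hprod, hρ, Measure.map_map (by fun_prop) hτ]
  convert (Measure.map_id (μ := P ⊗ₘ kernel G)).symm
  ext p : 1
  simp [translate_neg_translate]

/-- Mecke's theorem: a `σ`-finite measure without mass at zero that satisfies Mecke's identity is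
the Palm measure of exactly one stationary measure without mass at zero. -/
theorem IsMecke.existsUnique [SigmaFinite Q] (hQ : IsMecke Q) (hQ0 : Q {0} = 0) :
    ∃! P : Measure (LocFinMeasure G), IsStationaryMeasureOf lam Q P := by
  obtain ⟨P, hP, hP0, hC⟩ := hQ.exists_compProd_eq (lam := lam) hQ0
  refine ⟨P, ⟨⟨sigmaFinite_of_compProd_eq hP0 hC, map_translate_eq_of_compProd_eq hP0 hC⟩, hP0,
    isPalmMeasure_of_compProd_eq hC⟩, fun P' hP' => ?_⟩
  have := hP'.isStationary.sigmaFinite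
  exact eq_of_compProd_eq hP'.zero_null hP0 (hP'.isPalmMeasure.compProd_eq.trans hC.symm)

end Campbell

/-! ### Transfer of invariant null events -/

section Ergodic

variable {G : Type*} [AddCommGroup G] [TopologicalSpace G] [IsTopologicalAddGroup G] [T2Space G]
  [LocallyCompactSpace G] [SecondCountableTopology G] [MeasurableSpace G] [BorelSpace G]
  {lam : Measure G} [lam.IsAddHaarMeasure] {P P₀ Q : Measure (LocFinMeasure G)}
  {ν : Measure (Displacement G)}

theorem mem_translate_iff {A : Set (LocFinMeasure G)} (hA : ∀ t : G, translate t '' A = A) (t : G)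
    (ξ : LocFinMeasure G) : translate t ξ ∈ A ↔ ξ ∈ A := by
  conv_rhs => rw [← hA (-t), image_translate, neg_neg]
  rfl

theorem image_prodMap_eq_of_mem_iff {C : Set (LocFinMeasure G × Displacement G)}
    (hC : ∀ t ξ B, (translate t ξ, shift t B) ∈ C ↔ (ξ, B) ∈ C) (t : G) :
    Prod.map (translate t) (shift t) '' C = C := by
  ext ⟨ξ, B⟩
  constructor
  · rintro ⟨⟨ξ', B'⟩, h, heq⟩
    rw [← heq]
    exact (hC t ξ' B').2 h
  · intro h
    exact ⟨(translate (-t) ξ, shift (-t) B), (hC (-t) ξ B).2 h,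
      Prod.ext (translate_translate_neg t ξ) (shift_shift_neg t B)⟩

/-- A `(τ, θ)`-invariant null event of `P ⊗ ν` is null for `P₀ ⊗ ν`: its sections at `ξ` and at
`τ_t ξ` have the same `ν`-measure, so the shift by `t` in the Palm formula is immaterial. -/
theorem IsPalmMeasure.prod_eq_zero (h : IsPalmMeasure lam P P₀) [SFinite P]
    (hν : IsWeaklyStationary ν) {C : Set (LocFinMeasure G × Displacement G)}
    (hC : MeasurableSet C) (hinv : ∀ t ξ B, (translate t ξ, shift t B) ∈ C ↔ (ξ, B) ∈ C)
    (h0 : (P.prod ν) C = 0) : (P₀.prod ν) C = 0 := by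
  have := hν.sigmaFinite
  have := h.sFinite
  obtain ⟨ω, hω, hω1⟩ := exists_lintegral_eq_one lam
  have hsec (t : G) (ξ : LocFinMeasure G) :
      ν (Prod.mk (translate t ξ) ⁻¹' C) = ν (Prod.mk ξ ⁻¹' C) := by
    conv_lhs => rw [← hν.map_shift t]
    rw [Measure.map_apply (by fun_prop) (measurable_prodMk_left hC)]
    congr 1
    ext B
    exact hinv t ξ B
  rw [Measure.prod_apply hC, h.lintegral_eq hω hω1 (measurable_measure_prodMk_left hC)]
  simp_rw [hsec]
  refine lintegral_eq_zero_of_ae_eq_zero ?_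
  filter_upwards [(Measure.measure_prod_null hC).1 h0] with ξ hξ
  have hξ' : ν (Prod.mk ξ ⁻¹' C) = 0 := hξ
  simp [hξ']

/-- A translation invariant event that is null for the Palm measure is null for the stationary
measure. -/
theorem measure_eq_zero_of_palm [SigmaFinite Q] (h : IsStationaryMeasureOf lam Q P)
    {A : Set (LocFinMeasure G)} (hA : MeasurableSet A) (hinv : ∀ t ξ, translate t ξ ∈ A ↔ ξ ∈ A)
    (h0 : Q A = 0) : P A = 0 := by
  have := h.isStationary.sigmaFinite
  obtain ⟨k, hk, hk1⟩ := exists_normalising_density G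
  have hA1 : Measurable (A.indicator (1 : LocFinMeasure G → ℝ≥0∞)) := measurable_one.indicator hA
  rw [← lintegral_indicator_one hA,
    lintegral_eq_of_compProd_eq h.zero_null h.isPalmMeasure.compProd_eq hk hk1 hA1,
    lintegral_campbell (by fun_prop)]
  refine lintegral_eq_zero_of_ae_eq_zero ?_
  filter_upwards [measure_eq_zero_iff_ae_notMem.1 h0] with ξ hξ
  have h' (t : G) : translate (-t) ξ ∉ A := fun ht => hξ ((hinv _ _).1 ht)
  simp [h']

/-- Joint ergodicity passes to the stationary measure of the perturbed Palm measure, because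
`Γ⁻¹ A` is `(τ, θ)`-invariant whenever `A` is `τ`-invariant. -/
theorem IsErgodic.of_isJointlyErgodic (hP : IsStationaryMeasureOf lam P₀ P)
    (hν : IsWeaklyStationary ν) [SigmaFinite (perturbedMeasure P₀ ν)]
    (herg : IsJointlyErgodic P ν) (hQ : IsStationaryMeasureOf lam (perturbedMeasure P₀ ν) Q) :
    IsErgodic Q := by
  have := hP.isStationary.sigmaFinite
  have hΓ : Measurable (perturb : LocFinMeasure G × Displacement G → _) :=
    measurable_perturb measurable_id
  refine ⟨hQ.isStationary, fun A hA hinv => ?_⟩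
  have hmem := mem_translate_iff hinv
  have hΓmem (t : G) (ξ : LocFinMeasure G) (B : Displacement G) :
      (translate t ξ, shift t B) ∈ perturb ⁻¹' A ↔ (ξ, B) ∈ perturb ⁻¹' A := by
    rw [Set.mem_preimage, perturb_translate_shift, hmem]
    rfl
  have hnull {A : Set (LocFinMeasure G)} (hA : MeasurableSet A)
      (hmem : ∀ t ξ, translate t ξ ∈ A ↔ ξ ∈ A)
      (hΓmem : ∀ t ξ B, (translate t ξ, shift t B) ∈ perturb ⁻¹' A ↔ (ξ, B) ∈ perturb ⁻¹' A)
      (h0 : (P.prod ν) (perturb ⁻¹' A) = 0) : Q A = 0 := by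
    refine measure_eq_zero_of_palm hQ hA hmem ?_
    rw [perturbedMeasure, Measure.map_apply hΓ hA]
    exact hP.isPalmMeasure.prod_eq_zero hν (hΓ hA) hΓmem h0
  refine (herg (perturb ⁻¹' A) (hΓ hA) (image_prodMap_eq_of_mem_iff hΓmem)).imp
    (hnull hA hmem hΓmem) (hnull hA.compl (fun t ξ => (hmem t ξ).not)
      fun t ξ B => (hΓmem t ξ B).not)

end Ergodic

end PalmPerturbation

theorem mainTheorem2 {G : Type*} [AddCommGroup G] [TopologicalSpace G] [IsTopologicalAddGroup G]
    [T2Space G] [LocallyCompactSpace G] [SecondCountableTopology G]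
    [MeasurableSpace G] [BorelSpace G]
    (lam : Measure G) [lam.IsAddHaarMeasure]
    (P P₀ : Measure (PalmPerturbation.LocFinMeasure G))
    (ν : Measure (PalmPerturbation.Displacement G))
    (hP : PalmPerturbation.IsStationaryMeasureOf lam P₀ P)
    (hν : PalmPerturbation.IsWeaklyStationary ν)
    (hfin : SigmaFinite (PalmPerturbation.perturbedMeasure P₀ ν))
    (herg : PalmPerturbation.IsJointlyErgodic P ν) :
    ∃ Pν : Measure (PalmPerturbation.LocFinMeasure G),
      PalmPerturbation.IsStationaryMeasureOf lam (PalmPerturbation.perturbedMeasure P₀ ν) Pν ∧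
      (∀ P' : Measure (PalmPerturbation.LocFinMeasure G),
        PalmPerturbation.IsStationaryMeasureOf lam (PalmPerturbation.perturbedMeasure P₀ ν) P' →
          P' = Pν) ∧
      PalmPerturbation.IsErgodic Pν := by
  have := hP.isStationary.sigmaFinite
  have := hν.sigmaFinite
  have := hP.isPalmMeasure.sFinite
  have hM : PalmPerturbation.IsMecke (PalmPerturbation.perturbedMeasure P₀ ν) :=
    (hP.isPalmMeasure.isMecke hP.isStationary).perturbedMeasure hν
  obtain ⟨Pν, hPν, huniq⟩ := hM.existsUnique (lam := lam)
    (PalmPerturbation.perturbedMeasure_singleton_zero hP.isPalmMeasure.singleton_zero)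
  exact ⟨Pν, hPν, huniq, .of_isJointlyErgodic hP hν herg hPν⟩
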